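/- Let $n\ge 0$ be an integer and let $\mathrm{XF}_1^{2n+3}$ be the simple graph on the vertex set $\{1,\dots,2n+7\}$ whose edges are $\{1,i\}$ for $2\le i\le 2n+5$, $\{i,i+1\}$ for $2\le i\le 2n+4$, $\{2n+5,2n+6\}$ and $\{2,2n+7\}$. Let $G=\mathrm{co\text{-}XF}_1^{2n+3}$ be the complement of $\mathrm{XF}_1^{2n+3}$. Let $\Bbbk$ be any field of characteristic $2$, and let $$J_G=\bigl(x_iy_j-x_jy_i \;:\; \{i,j\}\in E(G),\ i<j\bigr)\subset R=\Bbbk[x_1,\dots,x_{2n+7},y_1,\dots,y_{2n+7}]$$ be the binomial edge ideal of $G$. Then $J_G$ is not F-pure, that is, the ring $R_G=R/J_G$ is not F-pure. Here a commutative ring $A$ of prime characteristic $p$ is called F-pure if for every $A$-module $M$ the map $M\to M\otimes_A F_*A$, $m\mapsto m\otimes F_*1$, is injective, where $F_*A$ denotes $A$ regarded as an $A$-module through the Frobenius endomorphism $r\mapsto r^p$. -/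

import Mathlib

open scoped TensorProduct

universe u

/-- `F_* R`: the ring `R` regarded as an `R`-module through the Frobenius `r ↦ r ^ p`. -/
def FrobeniusModule (_p : ℕ) (R : Type u) : Type u := R

namespace FrobeniusModule

variable (p : ℕ) (R : Type u) [CommRing R]

instance : AddCommGroup (FrobeniusModule p R) := inferInstanceAs (AddCommGroup R)

/-- The scalar action `r • F_* s = F_* (r ^ p * s)`. -/
noncomputable instance [Fact p.Prime] [CharP R p] : Module R (FrobeniusModule p R) :=
  Module.compHom R (frobenius R p)

/-- The Frobenius map `F : R → F_* R`, `r ↦ F_* (r ^ p)`, as an `R`-linear map. -/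
noncomputable def frobeniusMap [Fact p.Prime] [CharP R p] : R →ₗ[R] FrobeniusModule p R where
  toFun r := (r ^ p : R)
  map_add' r s := add_pow_expChar r s p
  map_smul' r s := mul_pow r s p

end FrobeniusModule

/-- A ring `R` of prime characteristic `p` is F-pure if for every `R`-module `M` the map
`M ≃ M ⊗ R → M ⊗ F_* R` induced by Frobenius is injective. -/
def IsFPure (p : ℕ) [Fact p.Prime] (R : Type u) [CommRing R] [CharP R p] : Prop :=
  ∀ (M : Type u) [AddCommGroup M] [Module R M],
    Function.Injective
      ((FrobeniusModule.frobeniusMap p R).lTensor M ∘ₗ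
        (TensorProduct.rid R M).symm.toLinearMap :
        M →ₗ[R] M ⊗[R] FrobeniusModule p R)

section BinomialEdge

variable (k : Type u) [Field k] {V : Type} (G : SimpleGraph V)

/-- The binomial `x_i y_j - x_j y_i`; here `x_i` is the variable `Sum.inl i` and `y_i` is the
variable `Sum.inr i`. -/
noncomputable def edgeBinomial (i j : V) : MvPolynomial (V ⊕ V) k :=
  MvPolynomial.X (Sum.inl i) * MvPolynomial.X (Sum.inr j) -
    MvPolynomial.X (Sum.inl j) * MvPolynomial.X (Sum.inr i)

/-- The binomial edge ideal `J_G` in the polynomial ring `k[x_v, y_v : v ∈ V]`. (An edge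
contributes a binomial and its negative, so no order on the vertices is needed.) -/
noncomputable def binomialEdgeIdeal : Ideal (MvPolynomial (V ⊕ V) k) :=
  Ideal.span {f | ∃ i j : V, G.Adj i j ∧ f = edgeBinomial k i j}

/-- The quotient ring `R_G = k[x_v, y_v : v ∈ V] / J_G`. -/
abbrev BinomialEdgeRing : Type u := MvPolynomial (V ⊕ V) k ⧸ binomialEdgeIdeal k G

theorem binomialEdgeIdeal_ne_top : binomialEdgeIdeal k G ≠ ⊤ := by
  intro h
  have hle : binomialEdgeIdeal k G ≤
      RingHom.ker (MvPolynomial.eval (fun _ : V ⊕ V => (0 : k))) := by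
    refine Ideal.span_le.2 ?_
    rintro f ⟨i, j, -, rfl⟩
    simp [edgeBinomial, RingHom.mem_ker]
  have h1 : (1 : MvPolynomial (V ⊕ V) k) ∈ binomialEdgeIdeal k G := h ▸ Submodule.mem_top
  have h2 := hle h1
  simp [RingHom.mem_ker] at h2

instance : Nontrivial (BinomialEdgeRing k G) :=
  Ideal.Quotient.nontrivial_iff.2 (binomialEdgeIdeal_ne_top k G)

/-- `R_G` has the characteristic of the base field. -/
instance (p : ℕ) [CharP k p] : CharP (BinomialEdgeRing k G) p :=
  charP_of_injective_algebraMap (algebraMap k (BinomialEdgeRing k G)).injective p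

end BinomialEdge

/-- The graph `XF_1^{2n+3}` on the `2n + 7` vertices `1, …, 2n+7`, with edges `{1, i}` for
`2 ≤ i ≤ 2n+5`, `{i, i+1}` for `2 ≤ i ≤ 2n+4`, `{2n+5, 2n+6}` and `{2, 2n+7}`.
The element `v` of `Fin (2n+7)` stands for the vertex with label `v + 1`. -/
def graphXF1 (n : ℕ) : SimpleGraph (Fin (2 * n + 7)) :=
  SimpleGraph.fromRel fun v w =>
    let a := (v : ℕ) + 1
    let b := (w : ℕ) + 1
    (a = 1 ∧ 2 ≤ b ∧ b ≤ 2 * n + 5) ∨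
      (2 ≤ a ∧ a ≤ 2 * n + 4 ∧ b = a + 1) ∨
      (a = 2 * n + 5 ∧ b = 2 * n + 6) ∨
      (a = 2 ∧ b = 2 * n + 7)

/-- The graph `co-XF_1^{2n+3}`, the complement of `XF_1^{2n+3}`. -/
def graphCoXF1 (n : ℕ) : SimpleGraph (Fin (2 * n + 7)) := (graphXF1 n)ᶜ

/-! Purity of Frobenius is tested on one linear system over `R_G`, with an unknown for each pair of
vertices. In characteristic 2 its Frobenius twist is solved by the products `x_i y_i x_j y_j`, so
F-purity solves the system itself (`IsFPure.exists_solution`). The coefficients of `x_i y_j` in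
lifts of that solution are weights `a i j` satisfying the relations of `exists_weights_of_isFPure`,
a linearized form of forcing in transitive orientations of the complement. In `XF_1^{2n+3}` forcing
identifies the two directions of one edge whose ends have a common neighbour in `G`, so `2a = 1`,
which is absurd in characteristic 2. -/

/-- Over an F-pure ring, a finite linear system is solvable as soon as its Frobenius twist is. -/
theorem IsFPure.exists_solution {p : ℕ} [Fact p.Prime] {R : Type u} [CommRing R] [CharP R p]
    (hR : IsFPure p R) {E U : Type} [Fintype E] [Fintype U] (A : E → U → R) (c : E → R)
    (w : U → R) (hw : ∀ e, ∑ u, A e u ^ p * w u = c e ^ p) :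
    ∃ z : U → R, ∀ e, ∑ u, A e u * z u = c e := by
  classical
  let L : (U → R) →ₗ[R] (E → R) := Matrix.mulVecLin (Matrix.of A)
  let N : Submodule R (E → R) := LinearMap.range L
  let δ : E → (E → R) ⧸ N := fun e => N.mkQ (Pi.single e 1)
  have hmk : ∀ f : E → R, N.mkQ f = ∑ e, f e • δ e := by
    intro f
    conv_lhs => rw [pi_eq_sum_univ' f]
    rw [map_sum]
    refine Finset.sum_congr rfl fun e _ => ?_
    rw [map_smul]
  have hcol : ∀ u, ∑ e, A e u • δ e = 0 := by
    intro u
    rw [← hmk fun e => A e u]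
    refine (Submodule.Quotient.mk_eq_zero N).2 ⟨Pi.single u 1, ?_⟩
    funext e
    simp [L]
  have hsmul : ∀ (r : R) (m : (E → R) ⧸ N) (s : FrobeniusModule p R),
      (r • m) ⊗ₜ[R] s = m ⊗ₜ[R] (show FrobeniusModule p R from (r ^ p * show R from s : R)) :=
    fun r m s => TensorProduct.smul_tmul r m s
  -- The class of `c` in the cokernel of `A` dies after tensoring with `F_* R`: the twisted
  -- equations rewrite it through the columns of `A`, which vanish in the cokernel.
  have hzero : N.mkQ c = 0 := by
    apply hR ((E → R) ⧸ N)
    rw [map_zero]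
    change N.mkQ c ⊗ₜ[R] (show FrobeniusModule p R from ((1 : R) ^ p : R)) = 0
    rw [hmk c, TensorProduct.sum_tmul]
    have step : ∀ e, (c e • δ e) ⊗ₜ[R] (show FrobeniusModule p R from ((1 : R) ^ p : R)) =
        ∑ u, (A e u • δ e) ⊗ₜ[R] (show FrobeniusModule p R from w u) := by
      intro e
      have h1 : (c e ^ p * (1 : R) ^ p : R) = ∑ u, A e u ^ p * w u := by
        rw [hw, one_pow, mul_one]
      rw [hsmul, Finset.sum_congr rfl fun u _ => hsmul (A e u) (δ e) (w u),
        ← TensorProduct.tmul_sum]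
      exact congrArg (fun t : FrobeniusModule p R => δ e ⊗ₜ[R] t) h1
    rw [Finset.sum_congr rfl fun e _ => step e, Finset.sum_comm]
    refine Finset.sum_eq_zero fun u _ => ?_
    rw [← TensorProduct.sum_tmul, hcol, TensorProduct.zero_tmul]
  obtain ⟨z, hz⟩ := (Submodule.Quotient.mk_eq_zero N).1 hzero
  exact ⟨z, fun e => congrFun hz e⟩

/-! ### Linear functionals vanishing on binomial edge ideals -/

section MonomialSums

open MvPolynomial

variable {k : Type u} [Field k]

open Classical in
/-- The sum of the coefficients of a polynomial at the exponents in `M`. -/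
noncomputable def coeffSum {σ : Type} (M : Set (σ →₀ ℕ)) : MvPolynomial σ k →ₗ[k] k :=
  (basisMonomials σ k).constr k fun e => if e ∈ M then 1 else 0

open Classical in
theorem coeffSum_monomial {σ : Type} (M : Set (σ →₀ ℕ)) (e : σ →₀ ℕ) :
    coeffSum M (monomial e (1 : k)) = if e ∈ M then 1 else 0 := by
  have := (basisMonomials σ k).constr_basis k (fun e => if e ∈ M then (1 : k) else 0) e
  simpa [coeffSum] using this

theorem coeffSum_X_mul {σ : Type} {M M' : Set (σ →₀ ℕ)} (s : σ)
    (h : ∀ e, e + Finsupp.single s 1 ∈ M ↔ e ∈ M') (f : MvPolynomial σ k) :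
    coeffSum M (X s * f) = coeffSum M' f := by
  classical
  have : (coeffSum (k := k) M).comp (LinearMap.mulLeft k (X s)) = coeffSum M' := by
    refine (basisMonomials σ k).ext fun e => ?_
    rw [coe_basisMonomials, LinearMap.comp_apply, LinearMap.mulLeft_apply, mul_comm, X,
      monomial_mul, mul_one, coeffSum_monomial, coeffSum_monomial]
    simp only [h]
  exact LinearMap.congr_fun this f

theorem coeffSum_union {σ : Type} {M M' : Set (σ →₀ ℕ)} (h : Disjoint M M')
    (f : MvPolynomial σ k) : coeffSum (M ∪ M') f = coeffSum M f + coeffSum M' f := by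
  classical
  have : coeffSum (k := k) (M ∪ M') = coeffSum M + coeffSum M' := by
    refine (basisMonomials σ k).ext fun e => ?_
    rw [coe_basisMonomials, LinearMap.add_apply, coeffSum_monomial, coeffSum_monomial,
      coeffSum_monomial]
    have : e ∈ M → e ∉ M' := fun h1 => Set.disjoint_left.1 h h1
    by_cases h1 : e ∈ M <;> by_cases h2 : e ∈ M' <;> simp [h1, h2]
    exact absurd h2 (this h1)
  rw [this, LinearMap.add_apply]

/-- A coefficient sum over a set of exponents that is stable under `x_a y_b ↦ x_b y_a` for
all edges `ab` vanishes on the binomial edge ideal. -/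
theorem coeffSum_eq_zero {V : Type} {G : SimpleGraph V} {M : Set (V ⊕ V →₀ ℕ)}
    (hM : ∀ a b, G.Adj a b → ∀ d,
      d + (Finsupp.single (Sum.inl a) 1 + Finsupp.single (Sum.inr b) 1) ∈ M →
      d + (Finsupp.single (Sum.inl b) 1 + Finsupp.single (Sum.inr a) 1) ∈ M)
    {f : MvPolynomial (V ⊕ V) k} (hf : f ∈ binomialEdgeIdeal k G) : coeffSum M f = 0 := by
  classical
  -- The functional is only `k`-linear, so the induction covers all multiples of `f`.
  refine Submodule.span_induction
    (p := fun f _ => ∀ g, coeffSum M (g * f) = 0) ?_ ?_ ?_ ?_ hf 1 |> fun h => by simpa using h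
  · rintro _ ⟨a, b, hab, rfl⟩ g
    have : (coeffSum (k := k) M).comp (LinearMap.mulRight k (edgeBinomial k a b)) = 0 := by
      refine (basisMonomials _ k).ext fun d => ?_
      rw [coe_basisMonomials, LinearMap.comp_apply, LinearMap.mulRight_apply, edgeBinomial,
        mul_sub, X, X, X, X, monomial_mul, monomial_mul, monomial_mul, monomial_mul]
      simp only [mul_one]
      rw [map_sub, coeffSum_monomial, coeffSum_monomial,
        if_congr (Iff.intro (hM a b hab d) (hM b a hab.symm d)) rfl rfl, sub_self,
        LinearMap.zero_apply]
    exact LinearMap.congr_fun this g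
  · simp
  · intro f g _ _ h1 h2 h
    rw [mul_add, map_add, h1, h2, add_zero]
  · intro r f _ h g
    rw [smul_eq_mul, ← mul_assoc, h]

end MonomialSums

/-! ### From F-purity to weights on non-edges -/

section Orientation

open MvPolynomial

variable {V : Type} [DecidableEq V]

/-- The exponents of `x_i y_j` for `i ≠ j`. -/
def pairExponents (i j : V) : Set (V ⊕ V →₀ ℕ) :=
  {e | (∀ v, e (Sum.inl v) + e (Sum.inr v) = (if v = i then 1 else 0) + if v = j then 1 else 0) ∧
    e (Sum.inr i) = 0 ∧ e (Sum.inr j) = 1}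

/-- The exponents of multidegree `l + i + j` with `y`-degree `t` at `l` and `s` at `i` and `j`:
for `(t, s) = (0, 1)` those of `x_l x_j y_i` and `x_l x_i y_j`, for `(t, s) = (1, 0)` that of
`x_i x_j y_l`. -/
def forcingExponents (t s : ℕ) (l i j : V) : Set (V ⊕ V →₀ ℕ) :=
  {e | (∀ v, e (Sum.inl v) + e (Sum.inr v) =
      (if v = l then 1 else 0) + (if v = i then 1 else 0) + if v = j then 1 else 0) ∧
    e (Sum.inr l) = t ∧ e (Sum.inr i) + e (Sum.inr j) = s}

/-- The exponents of `x_l x_i y_j`, `x_l x_j y_i` and `x_i x_j y_l`. -/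
def triangleExponents (l i j : V) : Set (V ⊕ V →₀ ℕ) :=
  {e | (∀ v, e (Sum.inl v) + e (Sum.inr v) =
      (if v = l then 1 else 0) + (if v = i then 1 else 0) + if v = j then 1 else 0) ∧
    e (Sum.inr l) + e (Sum.inr i) + e (Sum.inr j) = 1}

theorem add_single_mem_forcingExponents_right {l i j : V} (hli : l ≠ i) (hlj : l ≠ j) (hij : i ≠ j)
    (e : V ⊕ V →₀ ℕ) :
    e + Finsupp.single (Sum.inl j) 1 ∈ forcingExponents 0 1 l i j ↔ e ∈ pairExponents l i := by
  simp only [forcingExponents, pairExponents, Set.mem_ofPred_eq, Finsupp.add_apply,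
    Finsupp.single_apply, Sum.inl.injEq, reduceCtorEq, if_false, add_zero]
  constructor
  · rintro ⟨h1, h2⟩
    have hl := h1 l
    have hi := h1 i
    have hj := h1 j
    grind
  · intro h
    grind

theorem add_single_mem_forcingExponents_left {l i j : V} (hli : l ≠ i) (hlj : l ≠ j) (hij : i ≠ j)
    (e : V ⊕ V →₀ ℕ) :
    e + Finsupp.single (Sum.inl i) 1 ∈ forcingExponents 0 1 l i j ↔ e ∈ pairExponents l j := by
  simp only [forcingExponents, pairExponents, Set.mem_ofPred_eq, Finsupp.add_apply,
    Finsupp.single_apply, Sum.inl.injEq, reduceCtorEq, if_false, add_zero]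
  constructor
  · rintro ⟨h1, h2⟩
    have hl := h1 l
    have hi := h1 i
    have hj := h1 j
    grind
  · intro h
    grind

theorem add_single_mem_forcingExponents_right' {l i j : V} (hli : l ≠ i) (hlj : l ≠ j) (hij : i ≠ j)
    (e : V ⊕ V →₀ ℕ) :
    e + Finsupp.single (Sum.inl j) 1 ∈ forcingExponents 1 0 l i j ↔ e ∈ pairExponents i l := by
  simp only [forcingExponents, pairExponents, Set.mem_ofPred_eq, Finsupp.add_apply,
    Finsupp.single_apply, Sum.inl.injEq, reduceCtorEq, if_false, add_zero]
  constructor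
  · rintro ⟨h1, h2⟩
    have hl := h1 l
    have hi := h1 i
    have hj := h1 j
    grind
  · intro h
    grind

theorem add_single_mem_forcingExponents_left' {l i j : V} (hli : l ≠ i) (hlj : l ≠ j) (hij : i ≠ j)
    (e : V ⊕ V →₀ ℕ) :
    e + Finsupp.single (Sum.inl i) 1 ∈ forcingExponents 1 0 l i j ↔ e ∈ pairExponents j l := by
  simp only [forcingExponents, pairExponents, Set.mem_ofPred_eq, Finsupp.add_apply,
    Finsupp.single_apply, Sum.inl.injEq, reduceCtorEq, if_false, add_zero]
  constructor
  · rintro ⟨h1, h2⟩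
    have hl := h1 l
    have hi := h1 i
    have hj := h1 j
    grind
  · intro h
    grind

theorem add_single_mem_triangleExponents {l i j : V} (hli : l ≠ i) (hlj : l ≠ j) (hij : i ≠ j)
    (e : V ⊕ V →₀ ℕ) :
    e + Finsupp.single (Sum.inl l) 1 ∈ triangleExponents l i j ↔
      e ∈ pairExponents i j ∪ pairExponents j i := by
  simp only [triangleExponents, pairExponents, Set.mem_union, Set.mem_ofPred_eq,
    Finsupp.add_apply, Finsupp.single_apply, Sum.inl.injEq, reduceCtorEq, if_false, add_zero]
  constructor
  · rintro ⟨h1, h2⟩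
    have hl := h1 l
    have hi := h1 i
    have hj := h1 j
    grind
  · intro h
    grind

variable {k : Type u} [Field k] {G : SimpleGraph V}

/-- Every move `x_a y_b ↦ x_b y_a` preserves the multidegree and the total `y`-degree. -/
theorem coeffSum_triangleExponents_eq_zero (l i j : V) (hli : l ≠ i) (hlj : l ≠ j) (hij : i ≠ j)
    {f : MvPolynomial (V ⊕ V) k} (hf : f ∈ binomialEdgeIdeal k G) :
    coeffSum (triangleExponents l i j) f = 0 := by
  refine coeffSum_eq_zero (fun a b hab d hd => ?_) hf
  obtain ⟨h1, h2⟩ := hd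
  have hne := hab.ne
  have ha := h1 a
  have hb := h1 b
  refine ⟨fun v => ?_, ?_⟩
  · rw [← h1 v]
    simp [Finsupp.single_apply]
    omega
  · simp [Finsupp.single_apply] at h2 ha hb ⊢
    grind

/-- In this multidegree only the edge `ij` can act, so the `y`-degree at `l` is preserved too. -/
theorem coeffSum_forcingExponents_eq_zero (t s : ℕ) (l i j : V) (hli : l ≠ i) (hlj : l ≠ j)
    (hij : i ≠ j) (hi : ¬ G.Adj l i) (hj : ¬ G.Adj l j)
    {f : MvPolynomial (V ⊕ V) k} (hf : f ∈ binomialEdgeIdeal k G) :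
    coeffSum (forcingExponents t s l i j) f = 0 := by
  refine coeffSum_eq_zero (fun a b hab d hd => ?_) hf
  obtain ⟨h1, h2, h3⟩ := hd
  have hne := hab.ne
  have hs := hab.symm
  have ha := h1 a
  have hb := h1 b
  refine ⟨fun v => ?_, ?_⟩
  · rw [← h1 v]
    simp [Finsupp.single_apply]
    omega
  · simp [Finsupp.single_apply] at h2 h3 ha hb ⊢
    grind

/-- If `R_G` is F-pure in characteristic `2`, the non-edges of `G` carry weights that are
constant under forcing and whose two directions add up to `1` when there is a common neighbour. -/
theorem exists_weights_of_isFPure [Fintype V] [CharP k 2] (h : IsFPure 2 (BinomialEdgeRing k G)) :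
    ∃ a : V → V → k,
      (∀ l i j, l ≠ i → l ≠ j → ¬ G.Adj l i → ¬ G.Adj l j → G.Adj i j →
        a l i = a l j ∧ a i l = a j l) ∧
      ∀ l i j, i ≠ j → G.Adj l i → G.Adj l j → ¬ G.Adj i j → a i j + a j i = 1 := by
  classical
  let mk : MvPolynomial (V ⊕ V) k →+* BinomialEdgeRing k G :=
    Ideal.Quotient.mk (binomialEdgeIdeal k G)
  let x : V → BinomialEdgeRing k G := fun v => mk (X (Sum.inl v))
  let y : V → BinomialEdgeRing k G := fun v => mk (X (Sum.inr v))
  have hxy : ∀ i j, G.Adj i j → x i * y j = x j * y i := by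
    intro i j hij
    rw [← map_mul, ← map_mul]
    exact Ideal.Quotient.eq.2 (Ideal.subset_span ⟨i, j, hij, rfl⟩)
  let q : Sym2 V → BinomialEdgeRing k G :=
    Sym2.lift ⟨fun i j => x i * y i * (x j * y j), fun i j => mul_comm _ _⟩
  -- The equations are `x_j z_{li} = x_i z_{lj}` for edges `ij`, and `x_l z_{ij} = x_l x_i y_j` for
  -- common neighbours `l` of `i` and `j`.
  let A : (V × V × V) ⊕ (V × V × V) → Sym2 V → BinomialEdgeRing k G
    | Sum.inl (l, i, j), u => if G.Adj i j then
        (if u = s(l, i) then x j else 0) - (if u = s(l, j) then x i else 0) else 0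
    | Sum.inr (l, i, j), u => if G.Adj l i ∧ G.Adj l j then
        (if u = s(i, j) then x l else 0) else 0
  let c : (V × V × V) ⊕ (V × V × V) → BinomialEdgeRing k G
    | Sum.inl _ => 0
    | Sum.inr (l, i, j) => if G.Adj l i ∧ G.Adj l j then x l * x i * y j else 0
  obtain ⟨z, hz⟩ := h.exists_solution A c q (by
    rintro (⟨l, i, j⟩ | ⟨l, i, j⟩)
    · by_cases hij : G.Adj i j
      · simp [A, c, hij, sub_pow_expChar, ite_pow, sub_mul, q]
        linear_combination (x l * y l * x j * x i) * (- hxy i j hij)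
      · simp [A, c, hij]
    · by_cases hl : G.Adj l i ∧ G.Adj l j
      · simp [A, c, hl, ite_pow, q]
        linear_combination (x l * x i * x j * y j) * (hxy l i hl.1) -
          (x l * x i ^ 2 * y j) * (hxy l j hl.2)
      · simp [A, c, hl])
  choose f hf using fun e => Ideal.Quotient.mk_surjective (z e)
  have hforce : ∀ l i j, G.Adj i j →
      X (Sum.inl j) * f s(l, i) - X (Sum.inl i) * f s(l, j) ∈ binomialEdgeIdeal k G := by
    intro l i j hij
    have := hz (Sum.inl (l, i, j))
    simp [A, c, hij, sub_mul] at this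
    refine Ideal.Quotient.eq_zero_iff_mem.1 ?_
    rw [map_sub, map_mul, map_mul, hf, hf]
    exact this
  have htri : ∀ l i j, G.Adj l i → G.Adj l j →
      X (Sum.inl l) * f s(i, j) - X (Sum.inl l) * (X (Sum.inl i) * X (Sum.inr j)) ∈
        binomialEdgeIdeal k G := by
    intro l i j hi hj
    have := hz (Sum.inr (l, i, j))
    simp [A, c, hi, hj] at this
    refine Ideal.Quotient.eq.1 ?_
    rw [map_mul, hf, map_mul, map_mul, ← mul_assoc]
    exact this
  refine ⟨fun i j => coeffSum (pairExponents i j) (f s(i, j)), ?_, ?_⟩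
  · intro l i j hli hlj hi hj hij
    have hne := hij.ne
    constructor
    · have := coeffSum_forcingExponents_eq_zero 0 1 l i j hli hlj hne hi hj (hforce l i j hij)
      rw [map_sub, coeffSum_X_mul (M' := pairExponents l i),
        coeffSum_X_mul (M' := pairExponents l j), sub_eq_zero] at this
      · exact this
      · exact add_single_mem_forcingExponents_left hli hlj hne
      · exact add_single_mem_forcingExponents_right hli hlj hne
    · have := coeffSum_forcingExponents_eq_zero 1 0 l i j hli hlj hne hi hj (hforce l i j hij)
      rw [map_sub, coeffSum_X_mul (M' := pairExponents i l),
        coeffSum_X_mul (M' := pairExponents j l), sub_eq_zero] at this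
      · simpa only [Sym2.eq_swap (a := l)] using this
      · exact add_single_mem_forcingExponents_left' hli hlj hne
      · exact add_single_mem_forcingExponents_right' hli hlj hne
  · intro l i j hne hi hj hij
    have := coeffSum_triangleExponents_eq_zero l i j hi.ne hj.ne hne (htri l i j hi hj)
    have hdisj : Disjoint (pairExponents i j) (pairExponents j i) :=
      Set.disjoint_left.2 fun e h1 h2 => by
        have := h1.2.1.symm.trans h2.2.2
        omega
    have hsh : ∀ e, e + Finsupp.single (Sum.inl l) 1 ∈ triangleExponents l i j ↔
        e ∈ pairExponents i j ∪ pairExponents j i :=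
      add_single_mem_triangleExponents hi.ne hj.ne hne
    have hone : coeffSum (pairExponents i j)
        (X (Sum.inl i) * X (Sum.inr j) : MvPolynomial (V ⊕ V) k) = 1 := by
      rw [X, X, monomial_mul, mul_one, coeffSum_monomial, if_pos]
      refine ⟨fun v => ?_, ?_, ?_⟩
      · simp [Finsupp.single_apply, eq_comm]
      · simp [hne.symm]
      · simp
    have hzero : coeffSum (pairExponents j i)
        (X (Sum.inl i) * X (Sum.inr j) : MvPolynomial (V ⊕ V) k) = 0 := by
      rw [X, X, monomial_mul, mul_one, coeffSum_monomial, if_neg]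
      intro h
      simpa using h.2.1
    rw [map_sub, coeffSum_X_mul _ hsh, coeffSum_X_mul _ hsh, coeffSum_union hdisj,
      coeffSum_union hdisj, hone, hzero, add_zero, sub_eq_zero] at this
    simpa only [Sym2.eq_swap (a := j)] using this

end Orientation

/-! ### The forcing cycle in `XF_1^{2n+3}` -/

theorem graphXF1_adj (n : ℕ) (v w : Fin (2 * n + 7)) : (graphXF1 n).Adj v w ↔ v ≠ w ∧
    (v.1 = 0 ∧ 1 ≤ w.1 ∧ w.1 ≤ 2 * n + 4 ∨ w.1 = 0 ∧ 1 ≤ v.1 ∧ v.1 ≤ 2 * n + 4 ∨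
      1 ≤ v.1 ∧ v.1 ≤ 2 * n + 4 ∧ w.1 = v.1 + 1 ∨ 1 ≤ w.1 ∧ w.1 ≤ 2 * n + 4 ∧ v.1 = w.1 + 1 ∨
      v.1 = 1 ∧ w.1 = 2 * n + 6 ∨ w.1 = 1 ∧ v.1 = 2 * n + 6) := by
  simp only [graphXF1, SimpleGraph.fromRel_adj]
  refine and_congr_right fun _ => ?_
  omega

theorem mainTheorem6 (n : ℕ) (k : Type u) [Field k] [CharP k 2] :
    ¬ IsFPure 2 (BinomialEdgeRing k (graphCoXF1 n)) := by
  intro h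
  obtain ⟨a, hforce, hsum⟩ := exists_weights_of_isFPure h
  have hadj : ∀ v w : Fin (2 * n + 7), (graphCoXF1 n).Adj v w ↔ v ≠ w ∧ ¬ (graphXF1 n).Adj v w :=
    fun v w => SimpleGraph.compl_adj _ v w
  simp only [hadj, graphXF1_adj, ne_eq, Fin.ext_iff] at hforce hsum
  -- Each forcing step reverses direction along the path, so steps of two preserve it; the even
  -- number of path vertices makes this reach the last edge.
  have hpath : ∀ m (hm : m ≤ n + 1), a ⟨2 * m + 1, by omega⟩ ⟨2 * m + 2, by omega⟩ =
      a ⟨1, by omega⟩ ⟨2 * n + 6, by omega⟩ := by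
    intro m
    induction m with
    | zero =>
      intro _
      exact (hforce ⟨1, by omega⟩ ⟨2, by omega⟩ ⟨2 * n + 6, by omega⟩ (by grind) (by grind)
        (by grind) (by grind) (by grind)).1
    | succ m ih =>
      intro hm
      rw [← ih (by omega)]
      refine Eq.trans ?_ (hforce ⟨2 * m + 2, by omega⟩ ⟨2 * m + 3, by omega⟩ ⟨2 * m + 1, by omega⟩
        (by grind) (by grind) (by grind) (by grind) (by grind)).2
      exact (hforce ⟨2 * m + 3, by omega⟩ ⟨2 * m + 4, by omega⟩ ⟨2 * m + 2, by omega⟩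
        (by grind) (by grind) (by grind) (by grind) (by grind)).1
  have hlast := hpath (n + 1) le_rfl
  have h1 := (hforce ⟨2 * n + 4, by omega⟩ ⟨2 * n + 3, by omega⟩ ⟨2 * n + 5, by omega⟩
    (by grind) (by grind) (by grind) (by grind) (by grind)).2
  have h2 := (hforce ⟨2 * n + 4, by omega⟩ ⟨0, by omega⟩ ⟨2 * n + 5, by omega⟩
    (by grind) (by grind) (by grind) (by grind) (by grind)).2
  have h3 := (hforce ⟨0, by omega⟩ ⟨1, by omega⟩ ⟨2 * n + 4, by omega⟩
    (by grind) (by grind) (by grind) (by grind) (by grind)).1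
  have h4 := (hforce ⟨1, by omega⟩ ⟨0, by omega⟩ ⟨2 * n + 6, by omega⟩
    (by grind) (by grind) (by grind) (by grind) (by grind)).1
  -- The pendant vertex `2n+5` is adjacent in `G` to both `0` and `1`; forcing makes both weights of
  -- this pair equal to `a 1 (2n+6)`.
  have h5 := hsum ⟨2 * n + 5, by omega⟩ ⟨0, by omega⟩ ⟨1, by omega⟩
    (by grind) (by grind) (by grind) (by grind)
  rw [h3, h2, ← h1, h4] at h5
  have h6 : a ⟨2 * n + 3, by omega⟩ ⟨2 * n + 4, by omega⟩ =
    a ⟨1, by omega⟩ ⟨2 * n + 6, by omega⟩ := hlast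
  rw [h6, CharTwo.add_self_eq_zero] at h5
  exact zero_ne_one h5
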